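/- Let $d\ge 0$ be an integer and let $\Omega\subseteq\mathbb R^d$ be a convex open domain, symmetric about $0$ (not necessarily bounded). For $x\in\mathbb R^d$ put $\|x\|:=\inf\{\lambda>0:\ \tfrac1\lambda x\in\Omega\}$. For $z\in\Omega$ let $$\mathcal M(\Omega,z):=\sup_{f\in\mathcal F(\Omega)} f(z),$$ where $\mathcal F(\Omega)$ is the class of positive definite functions $f:\mathbb R^d\to\mathbb R$ with (closed) support $\operatorname{supp} f\subseteq\Omega$ and $f(0)=1$. Suppose that $n\ge 1$ is an integer and that $$\frac1{n+1}\le\|z\|<\frac1n .$$ Then $$\mathcal M(\Omega,z)=\cos\frac{\pi}{n+2}.$$ This holds for each of the following readings of the class $\mathcal F(\Omega)$: 1. $f$ is continuous and integrable, and positive definite means that $\widehat f(\xi)=\int_{\mathbb R^d}e^{2\pi i\langle\xi,x\rangle}f(x)\,dx\ge 0$ for all $\xi\in\mathbb R^d$; 2. $f$ is integrable and continuous at $0$ and at $z$, and $\widehat f\ge0$ everywhere; 3. $f$ is $C^\infty$ with compact support, and $\widehat f\ge 0$ everywhere; 4. $f$ is continuous, and positive definite means that $\sum_{i,j=1}^m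 c_i\overline{c_j}\,f(x_i-x_j)\ge 0$ for all $m$, all $x_1,\dots,x_m\in\mathbb R^d$ and all $c_1,\dots,c_m\in\mathbb C$. -/

import Mathlib

open scoped ContDiff FourierTransform ComplexConjugate ComplexOrder
open MeasureTheory

noncomputable section

/-- The space `ℝ^d` with its Euclidean structure. -/
abbrev RSpace (d : ℕ) : Type := EuclideanSpace ℝ (Fin d)

/-- Positive definiteness on `ℝ^d` in terms of finite quadratic forms. The order on `ℂ` is such
that `0 ≤ w` means that `w` is real and nonnegative. -/
def IsPosDefPointwise {d : ℕ} (f : RSpace d → ℝ) : Prop :=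
  ∀ (m : ℕ) (x : Fin m → RSpace d) (c : Fin m → ℂ),
    0 ≤ ∑ i, ∑ j, c i * conj (c j) * (f (x i - x j) : ℂ)

/-- Positive definiteness of an integrable function in terms of its Fourier transform: `f` is
integrable and its Fourier transform is real and nonnegative everywhere. -/
def IsPosDefFourier {d : ℕ} (f : RSpace d → ℝ) : Prop :=
  Integrable f volume ∧ ∀ ξ : RSpace d, 0 ≤ 𝓕 (fun x => (f x : ℂ)) ξ

/-- The class `𝓕(Ω)` of real functions that are positive definite, take the value `1` at the
origin and have their (closed) support in `Ω`; the notion of positive definiteness is a parameter,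
and so is the regularity that is asked of the functions. -/
def admissible {d : ℕ} (posDef regular : (RSpace d → ℝ) → Prop) (Ω : Set (RSpace d)) :
    Set (RSpace d → ℝ) :=
  {f | tsupport f ⊆ Ω ∧ f 0 = 1 ∧ posDef f ∧ regular f}

/-- The supremum of the values `f z` over a class of functions, in the extended reals (so that it
is a genuine supremum in every case). -/
def extremalValue {d : ℕ} (F : Set (RSpace d → ℝ)) (z : RSpace d) : EReal :=
  ⨆ f ∈ F, ((f z : ℝ) : EReal)

/-- `𝓜(Ω, z)` for integrable functions that are continuous at `0` and at `z`. -/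
def extremalL1 {d : ℕ} (Ω : Set (RSpace d)) (z : RSpace d) : EReal :=
  extremalValue (admissible IsPosDefFourier (fun f => ContinuousAt f 0 ∧ ContinuousAt f z) Ω) z

/-- `𝓜(Ω, z)` for continuous integrable functions. -/
def extremalC {d : ℕ} (Ω : Set (RSpace d)) (z : RSpace d) : EReal :=
  extremalValue (admissible IsPosDefFourier Continuous Ω) z

/-- `𝓜(Ω, z)` for compactly supported `C^∞` functions. -/
def extremalSmooth {d : ℕ} (Ω : Set (RSpace d)) (z : RSpace d) : EReal :=
  extremalValue (admissible IsPosDefFourier (fun f => ContDiff ℝ ∞ f ∧ HasCompactSupport f) Ω) z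

/-- `𝓜(Ω, z)` for continuous functions that are positive definite in the pointwise sense. -/
def extremalPointwise {d : ℕ} (Ω : Set (RSpace d)) (z : RSpace d) : EReal :=
  extremalValue (admissible IsPosDefPointwise Continuous Ω) z

end

/-! The bounds on `gauge Ω z` say that k z lies in Ω exactly when |k| ≤ n. Sampling f along the
multiples of z therefore gives a positive definite sequence that vanishes for |k| > n. Its Fourier
series is a nonnegative trigonometric polynomial of degree at most n, and Fejér's inequality
(`IsPosDefSeq.fejer`) bounds its first coefficient by cos(π/(n+2)) times its zeroth: sum the
polynomial over the (n+2)-th roots of -1 against the nonnegative weights cos(π/(n+2)) - cos θ.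

For the Fourier notion of positive definiteness, the samples are taken from the inverse transform of
the transform of f. This needs the transform to be integrable (`integrable_fourier_of_nonneg`).

For sharpness, put translates of a narrow bump at 0, z, ..., n z, with Fejér's sine coefficients.
The autocorrelation of this sum is smooth, positive definite in both senses, and supported near the
points k z with |k| ≤ n. On the multiples of z it reproduces the discrete autocorrelation of the
coefficients, so after normalization it attains the bound in all four classes. -/

/-! ### Fejér's inequality for positive definite sequences -/

/-- Positive definiteness of a two-sided complex sequence. -/
def IsPosDefSeq (a : ℤ → ℂ) : Prop :=
  ∀ (N : ℕ) (c : ℕ → ℂ),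
    0 ≤ ∑ i ∈ Finset.range N, ∑ j ∈ Finset.range N, c i * conj (c j) * a ((i : ℤ) - j)

/-- Enlarging the square adds an L-shaped border on which i - j takes each value from -N to N
exactly once. -/
theorem sum_range_succ_sum_range_succ_sub (b : ℤ → ℂ) (N : ℕ) :
    ∑ i ∈ Finset.range (N + 1), ∑ j ∈ Finset.range (N + 1), b ((i : ℤ) - j) =
      ∑ i ∈ Finset.range N, ∑ j ∈ Finset.range N, b ((i : ℤ) - j) +
        ∑ k ∈ Finset.range (2 * N + 1), b ((k : ℤ) - N) := by
  have h1 : ∑ k ∈ Finset.range (2 * N + 1), b ((k : ℤ) - N) =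
      ∑ i ∈ Finset.range N, b ((i : ℤ) - N) + ∑ j ∈ Finset.range (N + 1), b ((N : ℤ) - j) := by
    rw [show 2 * N + 1 = N + (N + 1) by ring, Finset.sum_range_add]
    congr 1
    rw [← Finset.sum_range_reflect]
    refine Finset.sum_congr rfl fun j hj => ?_
    have : j ≤ N := by simpa [Nat.lt_succ_iff] using hj
    congr 1
    omega
  rw [h1, Finset.sum_range_succ, ← add_assoc, ← Finset.sum_add_distrib]
  simp only [Finset.sum_range_succ]

theorem sum_range_shift_eq_of_support (b : ℤ → ℂ) (n : ℕ) (hb : ∀ k : ℤ, (n : ℤ) < |k| → b k = 0)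
    (m : ℕ) :
    ∑ k ∈ Finset.range (2 * (n + m) + 1), b ((k : ℤ) - (n + m : ℕ)) =
      ∑ k ∈ Finset.range (2 * n + 1), b ((k : ℤ) - n) := by
  induction m with
  | zero => rfl
  | succ m ih =>
    rw [← ih, show 2 * (n + (m + 1)) + 1 = (2 * (n + m) + 1 + 1) + 1 by ring,
      Finset.sum_range_succ, Finset.sum_range_succ']
    rw [hb _ (by rw [lt_abs]; push_cast; omega), hb _ (by rw [lt_abs]; push_cast; omega)]
    simp only [add_zero]
    refine Finset.sum_congr rfl fun k _ => ?_
    congr 1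
    push_cast
    ring

namespace IsPosDefSeq

variable {a : ℤ → ℂ} {n : ℕ}

/-- The total mass of a finitely supported positive definite sequence is nonnegative. -/
theorem re_sum_nonneg (ha : IsPosDefSeq a) (h0 : ∀ k : ℤ, (n : ℤ) < |k| → a k = 0) :
    0 ≤ (∑ k ∈ Finset.range (2 * n + 1), a ((k : ℤ) - n)).re := by
  set B := ∑ k ∈ Finset.range (2 * n + 1), a ((k : ℤ) - n) with hB
  set S : ℕ → ℂ := fun N => ∑ i ∈ Finset.range N, ∑ j ∈ Finset.range N, a ((i : ℤ) - j) with hS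
  -- Beyond size n each enlargement of the square adds the full mass B, so the form grows linearly;
  -- a negative real part of B would eventually make it negative.
  have hSB : ∀ m : ℕ, S (n + m) = S n + m * B := by
    intro m
    induction m with
    | zero => simp
    | succ m ih =>
      have := sum_range_succ_sum_range_succ_sub a (n + m)
      rw [sum_range_shift_eq_of_support a n h0 m] at this
      change S (n + m + 1) = S (n + m) + B at this
      rw [← add_assoc, this, ih]
      push_cast
      ring
  have hpos : ∀ N, 0 ≤ (S N).re := by
    intro N
    have := ha N (fun _ => 1)
    simp only [map_one, one_mul] at this
    exact (Complex.le_def.1 this).1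
  by_contra! hneg
  obtain ⟨m, hm⟩ := exists_nat_gt ((S n).re / -B.re)
  have h1 := hpos (n + m)
  rw [hSB, Complex.add_re, ← Complex.ofReal_natCast, Complex.re_ofReal_mul] at h1
  rw [div_lt_iff₀ (by linarith)] at hm
  linarith

/-- The factors u^i are absorbed into the test vector. Together with `re_sum_nonneg` this makes the
associated trigonometric polynomial nonnegative at every point of the unit circle. -/
theorem mul_zpow (ha : IsPosDefSeq a) {u : ℂ} (hu : ‖u‖ = 1) :
    IsPosDefSeq fun k => u ^ k * a k := by
  intro N c
  have hu0 : u ≠ 0 := by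
    rintro rfl
    simp at hu
  refine (ha N fun i => c i * u ^ i).trans_eq ?_
  refine Finset.sum_congr rfl fun i _ => Finset.sum_congr rfl fun j _ => ?_
  simp only
  rw [zpow_sub₀ hu0, map_mul, map_pow, ← Complex.inv_eq_conj hu]
  simp only [zpow_natCast, inv_pow]
  field_simp

end IsPosDefSeq

/-- The angles `(2j+1)π/N`: their exponentials are the `N`-th roots of `-1`. -/
noncomputable def oddAngle (N j : ℕ) : ℝ := (2 * j + 1) * Real.pi / N

/-- For k ≠ 0 the sum is geometric with ratio r = exp(2πik/N); here r^N = 1, and |k| < N forces r ≠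
1. -/
theorem sum_exp_oddAngle {N : ℕ} {k : ℤ} (hk : |k| < N) :
    ∑ j ∈ Finset.range N, Complex.exp (oddAngle N j * Complex.I) ^ k =
      if k = 0 then (N : ℂ) else 0 := by
  split_ifs with h0
  · simp [h0]
  have hN : (N : ℂ) ≠ 0 := by
    have : N ≠ 0 := by
      rintro rfl
      have := abs_nonneg k
      simp at hk
      omega
    exact_mod_cast this
  set r : ℂ := Complex.exp (2 * Real.pi * Complex.I * (k / N)) with hr
  have hr1 : r ≠ 1 := by
    rw [hr, Ne, Complex.exp_eq_one_iff]
    rintro ⟨m, hm⟩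
    have h1 : (k : ℂ) / N = m := by
      have := Complex.two_pi_I_ne_zero
      rw [mul_comm (m : ℂ)] at hm
      exact mul_left_cancel₀ this hm
    rw [div_eq_iff hN] at h1
    have h2 : k = m * N := by exact_mod_cast h1
    exact h0 (Int.eq_zero_of_abs_lt_dvd (m := N) ⟨m, by rw [h2]; ring⟩ hk)
  have hterm : ∀ j ∈ Finset.range N, Complex.exp (oddAngle N j * Complex.I) ^ k =
      Complex.exp (Real.pi * Complex.I * (k / N)) * r ^ j := by
    intro j _
    rw [hr, ← Complex.exp_int_mul, ← Complex.exp_nat_mul, ← Complex.exp_add]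
    congr 1
    rw [oddAngle]
    push_cast
    field_simp
    ring
  rw [Finset.sum_congr rfl hterm, ← Finset.mul_sum, geom_sum_eq hr1]
  have : r ^ N = 1 := by
    rw [hr, ← Complex.exp_nat_mul, Complex.exp_eq_one_iff]
    exact ⟨k, by field_simp⟩
  simp [this]

/-- The odd angles all lie in [π/N, 2π - π/N]. -/
theorem cos_oddAngle_le {N j : ℕ} (hj : j < N) :
    Real.cos (oddAngle N j) ≤ Real.cos (Real.pi / N) := by
  have hN : (0 : ℝ) < N := by exact_mod_cast (Nat.zero_le j).trans_lt hj
  have hpi := Real.pi_pos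
  have hj' : (j : ℝ) + 1 ≤ N := by exact_mod_cast hj
  have hlow : Real.pi / N ≤ oddAngle N j := by
    rw [oddAngle]
    gcongr
    have : (0 : ℝ) ≤ j := Nat.cast_nonneg j
    nlinarith
  have hhigh : oddAngle N j ≤ 2 * Real.pi - Real.pi / N := by
    rw [oddAngle, le_sub_iff_add_le, ← add_div, div_le_iff₀ hN]
    nlinarith
  rcases le_total (oddAngle N j) Real.pi with h | h
  · exact Real.cos_le_cos_of_nonneg_of_le_pi (by positivity) h hlow
  · rw [← Real.cos_two_pi_sub (oddAngle N j)]
    exact Real.cos_le_cos_of_nonneg_of_le_pi (by positivity) (by linarith) (by linarith)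

/-- Multiplying by the cosine shifts the frequency by ±1. The shifted frequencies stay below n + 2
in absolute value, so the quadrature has no aliasing: n + 2 nodes are just enough. -/
theorem sum_weight_mul_exp_oddAngle {n : ℕ} (C : ℂ) {k : ℤ} (hk : |k| ≤ n) :
    ∑ j ∈ Finset.range (n + 2), (C - Complex.cos (oddAngle (n + 2) j)) *
        Complex.exp (oddAngle (n + 2) j * Complex.I) ^ k =
      (n + 2) * ((if k = 0 then C else 0) - ((if k = 1 then 1 else 0) +
        (if k = -1 then 1 else 0)) / 2) := by
  have hterm : ∀ j ∈ Finset.range (n + 2), (C - Complex.cos (oddAngle (n + 2) j)) *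
        Complex.exp (oddAngle (n + 2) j * Complex.I) ^ k =
      C * Complex.exp (oddAngle (n + 2) j * Complex.I) ^ k -
        (Complex.exp (oddAngle (n + 2) j * Complex.I) ^ (k + 1) +
          Complex.exp (oddAngle (n + 2) j * Complex.I) ^ (k - 1)) / 2 := by
    intro j _
    rw [zpow_add₀ (Complex.exp_ne_zero _), zpow_sub₀ (Complex.exp_ne_zero _), Complex.cos,
      neg_mul, Complex.exp_neg, zpow_one]
    ring
  have hk' := abs_le.1 hk
  have e0 := sum_exp_oddAngle (N := n + 2) (k := k) (by push_cast; omega)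
  have e1 := sum_exp_oddAngle (N := n + 2) (k := k + 1) (by rw [abs_lt]; push_cast; omega)
  have e2 := sum_exp_oddAngle (N := n + 2) (k := k - 1) (by rw [abs_lt]; push_cast; omega)
  rw [Finset.sum_congr rfl hterm, Finset.sum_sub_distrib, ← Finset.mul_sum, ← Finset.sum_div,
    Finset.sum_add_distrib, e0, e1, e2]
  have i1 : k + 1 = 0 ↔ k = -1 := by omega
  have i2 : k - 1 = 0 ↔ k = 1 := by omega
  simp only [i1, i2]
  push_cast
  split_ifs <;> first | omega | ring

/-- Fejér's inequality for positive definite sequences supported in `[-n, n]`. -/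
theorem IsPosDefSeq.fejer {a : ℤ → ℂ} {n : ℕ} (hn : 1 ≤ n) (ha : IsPosDefSeq a)
    (h0 : ∀ k : ℤ, (n : ℤ) < |k| → a k = 0) :
    (a 1 + a (-1)).re / 2 ≤ Real.cos (Real.pi / (n + 2)) * (a 0).re := by
  set C : ℝ := Real.cos (Real.pi / (n + 2)) with hC
  set e : ℕ → ℂ := fun j => Complex.exp (oddAngle (n + 2) j * Complex.I) with he
  have hB : ∀ j, 0 ≤ (∑ k ∈ Finset.range (2 * n + 1), e j ^ ((k : ℤ) - n) * a ((k : ℤ) - n)).re :=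
    fun j => (ha.mul_zpow (Complex.norm_exp_ofReal_mul_I _)).re_sum_nonneg
      (n := n) fun k hk => by rw [h0 k hk, mul_zero]
  have hW : ∀ j ∈ Finset.range (n + 2), 0 ≤ C - Real.cos (oddAngle (n + 2) j) := by
    intro j hj
    have := cos_oddAngle_le (Finset.mem_range.1 hj)
    push_cast at this
    linarith
  have hsum : 0 ≤ (∑ j ∈ Finset.range (n + 2), ((C - Real.cos (oddAngle (n + 2) j) : ℝ) : ℂ) *
      ∑ k ∈ Finset.range (2 * n + 1), e j ^ ((k : ℤ) - n) * a ((k : ℤ) - n)).re := by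
    rw [Complex.re_sum]
    refine Finset.sum_nonneg fun j hj => ?_
    rw [Complex.re_ofReal_mul]
    exact mul_nonneg (hW j hj) (hB j)
  have hval : ∑ j ∈ Finset.range (n + 2), ((C - Real.cos (oddAngle (n + 2) j) : ℝ) : ℂ) *
      ∑ k ∈ Finset.range (2 * n + 1), e j ^ ((k : ℤ) - n) * a ((k : ℤ) - n) =
      ((n + 2 : ℝ) : ℂ) * (C * a 0 - (a 1 + a (-1)) / 2) := by
    simp only [Finset.mul_sum]
    rw [Finset.sum_comm]
    -- The index k stands for the frequency k - n. The truncated subtraction n - 1 is genuine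
    -- because n ≥ 1.
    have hk : ∀ k ∈ Finset.range (2 * n + 1),
        ∑ j ∈ Finset.range (n + 2), ((C - Real.cos (oddAngle (n + 2) j) : ℝ) : ℂ) *
          (e j ^ ((k : ℤ) - n) * a ((k : ℤ) - n)) =
        (n + 2) * ((if k = n then C * a 0 else 0) - ((if k = n + 1 then a 1 else 0) +
          (if k = n - 1 then a (-1) else 0)) / 2) := by
      intro k hk
      have hk' := Finset.mem_range.1 hk
      have hw := sum_weight_mul_exp_oddAngle (n := n) C (k := (k : ℤ) - n)
        (by rw [abs_le]; omega)
      push_cast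
      simp only [← mul_assoc]
      rw [← Finset.sum_mul, hw]
      have i0 : (k : ℤ) - n = 0 ↔ k = n := by omega
      have i1 : (k : ℤ) - n = 1 ↔ k = n + 1 := by omega
      have i2 : (k : ℤ) - n = -1 ↔ k = n - 1 := by omega
      simp only [i0, i1, i2]
      split_ifs with j0 j1 j2 j3 j4 j5 <;> first
        | omega
        | (rw [i0.2 ‹_›]; ring)
        | (rw [i1.2 ‹_›]; ring)
        | (rw [i2.2 ‹_›]; ring)
        | ring
    rw [Finset.sum_congr rfl hk, ← Finset.mul_sum, Finset.sum_sub_distrib, ← Finset.sum_div,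
      Finset.sum_add_distrib]
    simp only [Finset.sum_ite_eq', Finset.mem_range]
    rw [if_pos (by omega), if_pos (by omega), if_pos (by omega)]
    push_cast
    ring
  rw [hval, Complex.re_ofReal_mul] at hsum
  have hn2 : (0 : ℝ) < n + 2 := by positivity
  have := nonneg_of_mul_nonneg_right hsum hn2
  rw [Complex.sub_re, Complex.re_ofReal_mul] at this
  have h2 : ((a 1 + a (-1)) / 2).re = (a 1 + a (-1)).re / 2 := by
    rw [show (2 : ℂ) = ((2 : ℝ) : ℂ) by norm_num, Complex.div_ofReal_re]
  linarith

/-! ### Fourier inversion and sampling -/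

open Filter Topology in
/-- An integrable function with nonnegative Fourier transform that is continuous at the origin has
an integrable Fourier transform. -/
theorem integrable_fourier_of_nonneg {V : Type*} [NormedAddCommGroup V] [InnerProductSpace ℝ V]
    [MeasurableSpace V] [BorelSpace V] [FiniteDimensional ℝ V] {f : V → ℂ} (hf : Integrable f)
    (h0 : ContinuousAt f 0) (hpos : ∀ ξ, 0 ≤ 𝓕 f ξ) : Integrable (𝓕 f) := by
  have hcont : Continuous (𝓕 f) := VectorFourier.fourierIntegral_continuous
    Real.continuous_fourierChar (by exact continuous_inner) hf
  have hbound : ∀ ξ, ‖𝓕 f ξ‖ ≤ ∫ v, ‖f v‖ := fun ξ =>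
    VectorFourier.norm_fourierIntegral_le_integral_norm _ _ _ _ _
  have hgauss : ∀ c : ℝ, 0 < c →
      Integrable (fun w : V => Complex.exp (-(c⁻¹ : ℝ) * ‖w‖ ^ 2) * 𝓕 f w) := by
    intro c hc
    have J : Integrable fun w : V => Complex.exp (-(c⁻¹ : ℝ) * ‖w‖ ^ 2) := by
      simpa using GaussianFourier.integrable_cexp_neg_mul_sq_norm_add (V := V) (b := (c⁻¹ : ℝ))
        (by simpa using hc) 0 0
    exact J.mul_bdd (c := ∫ v, ‖f v‖) hcont.aestronglyMeasurable (ae_of_all _ hbound)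
  -- Moving the transform from f to the Gaussian turns the damped integral into a Gaussian average
  -- of f around 0, which converges by continuity there.
  have hT : Tendsto (fun c : ℝ => ∫ w : V, Complex.exp (-(c⁻¹ : ℝ) * ‖w‖ ^ 2) * 𝓕 f w) atTop
      (𝓝 (f 0)) := by
    refine (Real.tendsto_integral_gaussian_smul' hf h0).congr' ?_
    filter_upwards [Ioi_mem_atTop 0] with c (hc : 0 < c)
    have J : Integrable fun w : V => Complex.exp (-(c⁻¹ : ℝ) * ‖w‖ ^ 2 +
        2 * Real.pi * Complex.I * inner ℝ (0 : V) w) :=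
      GaussianFourier.integrable_cexp_neg_mul_sq_norm_add (by simpa using hc) _ _
    have H : ∫ w : V, 𝓕 (fun w : V => Complex.exp (-(c⁻¹ : ℝ) * ‖w‖ ^ 2 +
        2 * Real.pi * Complex.I * inner ℝ (0 : V) w)) w • f w =
        ∫ w : V, Complex.exp (-(c⁻¹ : ℝ) * ‖w‖ ^ 2 +
        2 * Real.pi * Complex.I * inner ℝ (0 : V) w) • 𝓕 f w := by
      simpa using! VectorFourier.integral_fourierIntegral_smul_eq_flip (L := innerₗ V)
        Real.continuous_fourierChar continuous_inner J hf
    simp only [inner_zero_left, Complex.ofReal_zero, mul_zero, add_zero, smul_eq_mul] at H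
    rw [← H]
    congr with w
    have hg := fourier_gaussian_innerProductSpace' (V := V) (b := ((c⁻¹ : ℝ) : ℂ))
      (by simpa using hc) 0 w
    simp only [inner_zero_left, Complex.ofReal_zero, mul_zero, add_zero] at hg
    rw [hg]
    simp only [smul_eq_mul]
    congr 2
    · simp
    · congr 1
      simp
      ring
  have hre : ∀ w, 0 ≤ (𝓕 f w).re := fun w => (Complex.le_def.1 (hpos w)).1
  set φ : ℕ → V → ℝ := fun m w => Real.exp (-(m + 1 : ℝ)⁻¹ * ‖w‖ ^ 2) * (𝓕 f w).re with hφ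
  have hφre : ∀ m w, φ m w =
      (Complex.exp (-(((m : ℝ) + 1)⁻¹ : ℝ) * ‖w‖ ^ 2) * 𝓕 f w).re := by
    intro m w
    rw [show Complex.exp (-(((m : ℝ) + 1)⁻¹ : ℝ) * ‖w‖ ^ 2) =
      ((Real.exp (-(m + 1 : ℝ)⁻¹ * ‖w‖ ^ 2) : ℝ) : ℂ) by push_cast; rfl, Complex.re_ofReal_mul]
  have hφint : ∀ m, Integrable (φ m) := by
    intro m
    refine (hgauss (m + 1) (by positivity)).re.congr (ae_of_all _ fun w => ?_)
    rw [hφre]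
    rfl
  have hφT : Tendsto (fun m => ∫ w, φ m w) atTop (𝓝 (f 0).re) := by
    have h1 : Tendsto (fun m : ℕ => (m : ℝ) + 1) atTop atTop :=
      tendsto_atTop_add_const_right _ _ tendsto_natCast_atTop_atTop
    refine ((Complex.continuous_re.tendsto _).comp (hT.comp h1)).congr fun m => ?_
    simp only [Function.comp_apply, hφre]
    exact (integral_re (hgauss (m + 1) (by positivity))).symm
  have hlim : ∀ w, Tendsto (fun m => ENNReal.ofReal (φ m w)) atTop
      (𝓝 (ENNReal.ofReal (𝓕 f w).re)) := by
    intro w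
    refine ENNReal.tendsto_ofReal ?_
    have h1 : Tendsto (fun m : ℕ => ((m : ℝ) + 1)⁻¹) atTop (𝓝 0) :=
      tendsto_inv_atTop_zero.comp
        (tendsto_atTop_add_const_right _ _ tendsto_natCast_atTop_atTop)
    have h2 : Tendsto (fun m => φ m w) atTop (𝓝 (Real.exp (-0 * ‖w‖ ^ 2) * (𝓕 f w).re)) :=
      ((Real.continuous_exp.tendsto _).comp (h1.neg.mul_const _)).mul_const _
    simpa using h2
  -- Fatou's lemma removes the Gaussian damping, since the integrands are nonnegative.
  have hfin : ∫⁻ w, ENNReal.ofReal (𝓕 f w).re ≤ ENNReal.ofReal (f 0).re := by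
    calc ∫⁻ w, ENNReal.ofReal (𝓕 f w).re
        = ∫⁻ w, liminf (fun m => ENNReal.ofReal (φ m w)) atTop := by
          simp only [fun w => (hlim w).liminf_eq]
      _ ≤ liminf (fun m => ∫⁻ w, ENNReal.ofReal (φ m w)) atTop :=
          lintegral_liminf_le' fun m => (hφint m).aemeasurable.ennreal_ofReal
      _ = ENNReal.ofReal (f 0).re := by
          refine Tendsto.liminf_eq ?_
          refine (ENNReal.tendsto_ofReal hφT).congr fun m => ?_
          exact ofReal_integral_eq_lintegral_ofReal (hφint m)
            (ae_of_all _ fun w => mul_nonneg (Real.exp_pos _).le (hre w))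
  refine ⟨hcont.aestronglyMeasurable, ?_⟩
  rw [hasFiniteIntegral_iff_norm]
  refine lt_of_le_of_lt (lintegral_mono fun w => ?_) (hfin.trans_lt ENNReal.ofReal_lt_top)
  have := congrArg Complex.re (Complex.norm_of_nonneg' (hpos w))
  rw [Complex.ofReal_re] at this
  rw [this]

/-- The inverse Fourier transform of a nonnegative function, restricted to the multiples of a
vector, is positive definite. -/
theorem isPosDefSeq_fourierInv {V : Type*} [NormedAddCommGroup V] [InnerProductSpace ℝ V]
    [MeasurableSpace V] [BorelSpace V] [FiniteDimensional ℝ V] {h : V → ℂ} (hh : Integrable h)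
    (hpos : ∀ ξ, 0 ≤ h ξ) (z : V) : IsPosDefSeq fun k => 𝓕⁻ h (k • z) := by
  intro N c
  have hint : ∀ x : V, Integrable fun v => (Real.fourierChar (inner ℝ v x) : ℂ) * h v := by
    intro x
    have := (Real.fourierIntegral_convergent_iff (f := h) (-x)).2 hh
    simpa [Circle.smul_def] using this
  -- The quadratic form is the integral of |p|² h, where p is the polynomial with coefficients c
  -- evaluated at the character of z.
  have key : ∑ i ∈ Finset.range N, ∑ j ∈ Finset.range N,
      c i * conj (c j) * 𝓕⁻ h (((i : ℤ) - j) • z) =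
      ∫ v, ((∑ i ∈ Finset.range N, c i * (Real.fourierChar (inner ℝ v z) : ℂ) ^ i) *
        conj (∑ i ∈ Finset.range N, c i * (Real.fourierChar (inner ℝ v z) : ℂ) ^ i)) * h v := by
    simp only [Real.fourierInv_eq, Circle.smul_def, smul_eq_mul]
    simp only [← integral_const_mul]
    have h1 : ∀ i ∈ Finset.range N, ∑ j ∈ Finset.range N, ∫ v, c i * conj (c j) *
        ((Real.fourierChar (inner ℝ v (((i : ℤ) - j) • z)) : ℂ) * h v) =
        ∫ v, ∑ j ∈ Finset.range N, c i * conj (c j) *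
        ((Real.fourierChar (inner ℝ v (((i : ℤ) - j) • z)) : ℂ) * h v) :=
      fun i _ => (integral_finsetSum _ fun j _ => (hint _).const_mul _).symm
    rw [Finset.sum_congr rfl h1, ← integral_finsetSum _ fun i _ =>
      integrable_finsetSum _ fun j _ => (hint _).const_mul _]
    congr with v
    rw [map_sum, Finset.sum_mul_sum, Finset.sum_mul]
    refine Finset.sum_congr rfl fun i _ => ?_
    rw [Finset.sum_mul]
    refine Finset.sum_congr rfl fun j _ => ?_
    have h2 : (Real.fourierChar (inner ℝ v (((i : ℤ) - j) • z)) : ℂ) =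
        (Real.fourierChar (inner ℝ v z) : ℂ) ^ i *
          conj ((Real.fourierChar (inner ℝ v z) : ℂ) ^ j) := by
      rw [map_pow, ← Circle.coe_inv_eq_conj, sub_smul, inner_sub_right, AddChar.map_sub_eq_div,
        natCast_zsmul, natCast_zsmul, ← Nat.cast_smul_eq_nsmul ℝ i, ← Nat.cast_smul_eq_nsmul ℝ j,
        inner_smul_right, inner_smul_right, ← nsmul_eq_mul, ← nsmul_eq_mul,
        AddChar.map_nsmul_eq_pow, AddChar.map_nsmul_eq_pow]
      simp [div_eq_mul_inv]
    rw [h2, map_mul]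
    ring
  rw [key]
  refine integral_nonneg fun v => ?_
  refine mul_nonneg ?_ (hpos v)
  rw [Complex.mul_conj]
  exact Complex.zero_le_real.2 (Complex.normSq_nonneg _)

/-- This supplies the sample at -z, where continuity of f is not assumed. -/
theorem fourierInv_neg_of_nonneg {V : Type*} [NormedAddCommGroup V] [InnerProductSpace ℝ V]
    [MeasurableSpace V] [BorelSpace V] [FiniteDimensional ℝ V] {h : V → ℂ}
    (hpos : ∀ ξ, 0 ≤ h ξ) (z : V) : 𝓕⁻ h (-z) = conj (𝓕⁻ h z) := by
  simp only [Real.fourierInv_eq, Circle.smul_def, smul_eq_mul]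
  rw [← integral_conj]
  congr with v
  rw [map_mul, Complex.conj_eq_iff_im.2 (Complex.le_def.1 (hpos v)).2.symm, inner_neg_right,
    AddChar.map_neg_eq_inv, Circle.coe_inv_eq_conj]

/-! ### Which multiples of z lie in Ω -/

section Geometry

variable {d : ℕ} {Ω : Set (RSpace d)} {z : RSpace d} {n : ℕ}

/-- The origin is the midpoint of x and -x; the empty set is excluded because its gauge is 0. -/
theorem zero_mem_of_gauge_pos (hconv : Convex ℝ Ω) (hsymm : ∀ x ∈ Ω, -x ∈ Ω)
    (hz : 0 < gauge Ω z) : (0 : RSpace d) ∈ Ω := by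
  rcases Ω.eq_empty_or_nonempty with rfl | ⟨x, hx⟩
  · simp at hz
  · have := hconv hx (hsymm x hx) (a := 1 / 2) (b := 1 / 2) (by norm_num) (by norm_num)
      (by norm_num)
    simpa using this

theorem gauge_zsmul (hsymm : ∀ x ∈ Ω, -x ∈ Ω) (k : ℤ) :
    gauge Ω (k • z) = |(k : ℝ)| * gauge Ω z := by
  have h1 : gauge Ω (k • z) = gauge Ω (|(k : ℝ)| • z) := by
    rw [← Int.cast_smul_eq_zsmul ℝ]
    rcases abs_cases (k : ℝ) with ⟨h, _⟩ | ⟨h, _⟩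
    · rw [h]
    · rw [h, neg_smul, gauge_neg hsymm]
  rw [h1, gauge_smul_of_nonneg (abs_nonneg _), smul_eq_mul]

theorem zsmul_notMem_of_le_gauge (hopen : IsOpen Ω) (hsymm : ∀ x ∈ Ω, -x ∈ Ω)
    (hz₁ : 1 / ((n : ℝ) + 1) ≤ gauge Ω z) {k : ℤ} (hk : (n : ℤ) < |k|) : k • z ∉ Ω := by
  intro hmem
  have h1 := gauge_lt_one_of_mem_of_isOpen hopen hmem
  rw [gauge_zsmul hsymm] at h1
  have h2 : (n : ℝ) + 1 ≤ |(k : ℝ)| := by exact_mod_cast hk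
  rw [div_le_iff₀ (by positivity)] at hz₁
  nlinarith [gauge_nonneg (s := Ω) z]

theorem zsmul_mem_of_gauge_lt (hopen : IsOpen Ω) (hconv : Convex ℝ Ω) (hsymm : ∀ x ∈ Ω, -x ∈ Ω)
    (h0 : (0 : RSpace d) ∈ Ω) (hn : 1 ≤ n) (hz₂ : gauge Ω z < 1 / (n : ℝ)) {k : ℤ}
    (hk : |k| ≤ n) : k • z ∈ Ω := by
  rw [← setOfPred_gauge_lt_one_eq_self_of_isOpen hconv h0 hopen]
  change gauge Ω (k • z) < 1
  rw [gauge_zsmul hsymm]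
  have h2 : |(k : ℝ)| ≤ n := by exact_mod_cast hk
  have hn' : (0 : ℝ) < n := by exact_mod_cast hn
  rw [lt_div_iff₀ hn'] at hz₂
  nlinarith [gauge_nonneg (s := Ω) z]

end Geometry

/-! ### The upper bound -/

theorem IsPosDefPointwise.isPosDefSeq {d : ℕ} {f : RSpace d → ℝ} (hf : IsPosDefPointwise f)
    (z : RSpace d) : IsPosDefSeq fun k => (f (k • z) : ℂ) := by
  intro N c
  refine (hf N (fun i => (i : ℕ) • z) (fun i => c i)).trans_eq ?_
  simp only [Finset.sum_range]
  refine Finset.sum_congr rfl fun i _ => Finset.sum_congr rfl fun j _ => ?_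
  rw [sub_smul, natCast_zsmul, natCast_zsmul]

/-- With points z, 0 and coefficients 1, i, the imaginary part of the form is f(-z) - f(z), and it
must vanish. -/
theorem IsPosDefPointwise.map_neg {d : ℕ} {f : RSpace d → ℝ} (hf : IsPosDefPointwise f)
    (z : RSpace d) : f (-z) = f z := by
  have := (Complex.le_def.1 (hf 2 ![z, 0] ![1, Complex.I])).2
  simp [Fin.sum_univ_two] at this
  linarith

section Upper

variable {d : ℕ} {Ω : Set (RSpace d)} {z : RSpace d} {n : ℕ}

theorem IsPosDefPointwise.le_cos {f : RSpace d → ℝ} (hf : IsPosDefPointwise f) (hn : 1 ≤ n)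
    (hsupp : ∀ k : ℤ, (n : ℤ) < |k| → k • z ∉ tsupport f) (h1 : f 0 = 1) :
    f z ≤ Real.cos (Real.pi / (n + 2)) := by
  have := (hf.isPosDefSeq z).fejer hn fun k hk => by
    rw [image_eq_zero_of_notMem_tsupport (hsupp k hk), Complex.ofReal_zero]
  simp [hf.map_neg, h1] at this
  linarith

theorem IsPosDefFourier.le_cos {f : RSpace d → ℝ} (hf : IsPosDefFourier f) (hn : 1 ≤ n)
    (hsupp : ∀ k : ℤ, (n : ℤ) < |k| → k • z ∉ tsupport f) (h1 : f 0 = 1)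
    (hc0 : ContinuousAt f 0) (hcz : ContinuousAt f z) :
    f z ≤ Real.cos (Real.pi / (n + 2)) := by
  obtain ⟨hint, hpos⟩ := hf
  set F : RSpace d → ℂ := fun x => (f x : ℂ) with hF
  have hFint : Integrable F := hint.ofReal
  have hFc : ∀ x, ContinuousAt f x → ContinuousAt F x := fun x hx =>
    Complex.continuous_ofReal.continuousAt.comp hx
  have hFF : Integrable (𝓕 F) := integrable_fourier_of_nonneg hFint (hFc 0 hc0) hpos
  have hinv : ∀ x, ContinuousAt f x → 𝓕⁻ (𝓕 F) x = f x := fun x hx =>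
    hFint.fourierInv_fourier_eq hFF (hFc x hx)
  -- Off the closed support f vanishes in a neighbourhood, hence is continuous there and inversion
  -- applies. At the other multiples of z only 0 and ±z matter, so no further continuity is needed.
  have := (isPosDefSeq_fourierInv hFF hpos z).fejer hn fun k hk => by
    have hk' := hsupp k hk
    rw [hinv, image_eq_zero_of_notMem_tsupport hk', Complex.ofReal_zero]
    exact (continuousAt_const (y := (0 : ℝ))).congr
      (notMem_tsupport_iff_eventuallyEq.1 hk').symm
  simp only [one_smul, neg_smul, zero_smul, fourierInv_neg_of_nonneg hpos, hinv 0 hc0,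
    hinv z hcz, h1, Complex.add_re, Complex.conj_re, Complex.ofReal_re] at this
  linarith

end Upper

/-! ### Autocorrelations are positive definite -/

/-- The autocorrelation `x ↦ ∫ F(t) F(t - x) dt` of a real function. -/
noncomputable def autocorrelation {d : ℕ} (F : RSpace d → ℝ) : RSpace d → ℝ :=
  convolution F (fun x => F (-x)) (ContinuousLinearMap.mul ℝ ℝ) volume

section Autocorrelation

variable {d : ℕ} {F : RSpace d → ℝ}

theorem autocorrelation_apply (F : RSpace d → ℝ) (x : RSpace d) :
    autocorrelation F x = ∫ t, F t * F (t - x) := by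
  simp [autocorrelation, convolution_def]

theorem contDiff_autocorrelation (hF : ContDiff ℝ ∞ F) (hc : HasCompactSupport F) :
    ContDiff ℝ ∞ (autocorrelation F) :=
  hc.contDiff_convolution_left _ hF (hF.continuous.comp continuous_neg).locallyIntegrable

theorem HasCompactSupport.comp_neg (hc : HasCompactSupport F) :
    HasCompactSupport fun x => F (-x) :=
  hc.comp_homeomorph (Homeomorph.neg _)

theorem hasCompactSupport_autocorrelation (hc : HasCompactSupport F) :
    HasCompactSupport (autocorrelation F) :=
  HasCompactSupport.convolution _ hc hc.comp_neg

/-- This makes the transform of an autocorrelation equal to the squared modulus of the transform of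
F. -/
theorem fourier_comp_neg_ofReal (F : RSpace d → ℝ) (ξ : RSpace d) :
    𝓕 (fun x => (F (-x) : ℂ)) ξ = conj (𝓕 (fun x => (F x : ℂ)) ξ) := by
  simp only [Real.fourier_eq, Circle.smul_def, smul_eq_mul]
  rw [← integral_conj, ← integral_neg_eq_self]
  congr with v
  simp only [map_mul, Complex.conj_ofReal, neg_neg, inner_neg_left, AddChar.map_neg_eq_inv,
    Circle.coe_inv_eq_conj, Complex.conj_conj]

theorem isPosDefFourier_autocorrelation (hF : Continuous F) (hc : HasCompactSupport F) :
    IsPosDefFourier (autocorrelation F) := by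
  have hi := hF.integrable_of_hasCompactSupport hc (μ := volume)
  have hi' : Integrable fun x => F (-x) := hi.comp_neg
  refine ⟨hi.integrable_convolution _ hi', fun ξ => ?_⟩
  have h1 : (fun x => (autocorrelation F x : ℂ)) =
      convolution (fun x => (F x : ℂ)) (fun x => (F (-x) : ℂ)) (ContinuousLinearMap.mul ℂ ℂ)
        volume := by
    ext x
    simp only [autocorrelation, convolution_def, ContinuousLinearMap.mul_apply']
    rw [← integral_complex_ofReal]
    simp
  have h2 : 𝓕 (fun x => (autocorrelation F x : ℂ)) ξ =
      𝓕 (fun x => (F x : ℂ)) ξ * conj (𝓕 (fun x => (F x : ℂ)) ξ) := by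
    rw [h1, ← fourier_comp_neg_ofReal]
    exact Real.fourier_mul_convolution_eq (R := ℂ) hi.ofReal hi'.ofReal ξ
  rw [h2, Complex.mul_conj]
  exact Complex.zero_le_real.2 (Complex.normSq_nonneg _)

/-- Translating the integration variable by x_i turns the quadratic form into the integral of |∑ c_i
F(t + x_i)|². -/
theorem isPosDefPointwise_autocorrelation (hF : Continuous F) (hc : HasCompactSupport F) :
    IsPosDefPointwise (autocorrelation F) := by
  intro m x c
  have hint : ∀ i j, Integrable fun t =>
      c i * conj (c j) * ((F (t + x i) * F (t + x j) : ℝ) : ℂ) := by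
    intro i j
    refine Integrable.const_mul (Integrable.ofReal ?_) _
    refine Continuous.integrable_of_hasCompactSupport
      ((hF.comp (by fun_prop)).mul (hF.comp (by fun_prop))) ?_
    exact (hc.comp_homeomorph (Homeomorph.addRight (x i))).mul_right
  have hval : ∀ i j, c i * conj (c j) * (autocorrelation F (x i - x j) : ℂ) =
      ∫ t, c i * conj (c j) * ((F (t + x i) * F (t + x j) : ℝ) : ℂ) := by
    intro i j
    rw [integral_const_mul, integral_complex_ofReal, autocorrelation_apply,
      ← integral_add_right_eq_self _ (x i)]
    congr 3 with t
    congr 2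
    abel
  have key : ∑ i, ∑ j, c i * conj (c j) * (autocorrelation F (x i - x j) : ℂ) =
      ∫ t, (∑ i, c i * F (t + x i)) * conj (∑ i, c i * F (t + x i)) := by
    simp only [hval]
    rw [Finset.sum_congr rfl fun i _ => (integral_finsetSum _ fun j _ => hint i j).symm,
      ← integral_finsetSum _ fun i _ => integrable_finsetSum _ fun j _ => hint i j]
    congr with t
    rw [map_sum, Finset.sum_mul_sum]
    refine Finset.sum_congr rfl fun i _ => Finset.sum_congr rfl fun j _ => ?_
    rw [map_mul, Complex.conj_ofReal]
    push_cast
    ring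
  rw [key]
  refine integral_nonneg fun t => ?_
  simp only [Complex.mul_conj]
  exact Complex.zero_le_real.2 (Complex.normSq_nonneg _)

end Autocorrelation

/-! ### Combinations of translated bumps -/

section TranslateSum

variable {d : ℕ}

/-- The combination `∑ β_j φ(x - j z)` of the translates of `φ`, where `j` runs from `0` to `n`. -/
def translateSum (φ : RSpace d → ℝ) (z : RSpace d) (n : ℕ) (β : ℕ → ℝ) (x : RSpace d) : ℝ :=
  ∑ j ∈ Finset.range (n + 1), β j * φ (x - j • z)

variable {φ : RSpace d → ℝ} {z : RSpace d} {n : ℕ} {δ : ℝ}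

theorem contDiff_translateSum (hφ : ContDiff ℝ ∞ φ) (β : ℕ → ℝ) :
    ContDiff ℝ ∞ (translateSum φ z n β) := by
  unfold translateSum
  fun_prop

theorem exists_norm_sub_le_of_translateSum_ne_zero (hφ : ∀ x, φ x ≠ 0 → ‖x‖ < δ) {β : ℕ → ℝ}
    {x : RSpace d} (hx : translateSum φ z n β x ≠ 0) : ∃ j ≤ n, ‖x - j • z‖ < δ := by
  obtain ⟨j, hj, hne⟩ := Finset.exists_ne_zero_of_sum_ne_zero hx
  exact ⟨j, Nat.lt_succ_iff.1 (Finset.mem_range.1 hj), hφ _ (right_ne_zero_of_mul hne)⟩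

theorem hasCompactSupport_translateSum (hφ : ∀ x, φ x ≠ 0 → ‖x‖ < δ) (β : ℕ → ℝ) :
    HasCompactSupport (translateSum φ z n β) := by
  refine HasCompactSupport.intro (K := ⋃ j ∈ Finset.range (n + 1), Metric.closedBall (j • z) δ)
    (Finset.isCompact_biUnion _ fun j _ => isCompact_closedBall _ _) fun x hx => ?_
  by_contra hne
  obtain ⟨j, hj, hlt⟩ := exists_norm_sub_le_of_translateSum_ne_zero hφ hne
  refine hx (Set.mem_biUnion (Finset.mem_coe.2 (Finset.mem_range.2 (Nat.lt_succ_iff.2 hj))) ?_)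
  rw [mem_closedBall_iff_norm]
  exact hlt.le

/-- If t is δ-close to i z and t - x is δ-close to j z, then x is 2δ-close to (i - j) z. The union
of the closed balls is closed, so it contains the closed support too. -/
theorem tsupport_autocorrelation_translateSum_subset (hφ : ∀ x, φ x ≠ 0 → ‖x‖ < δ) (β : ℕ → ℝ)
    {Ω : Set (RSpace d)}
    (hΩ : ∀ k : ℤ, |k| ≤ n → Metric.closedBall (k • z) (2 * δ) ⊆ Ω) :
    tsupport (autocorrelation (translateSum φ z n β)) ⊆ Ω := by
  set K := ⋃ k ∈ Finset.Icc (-n : ℤ) n, Metric.closedBall (k • z) (2 * δ) with hK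
  have hKc : IsClosed K :=
    (Finset.isCompact_biUnion _ fun j _ => isCompact_closedBall _ _).isClosed
  have hKΩ : K ⊆ Ω := Set.iUnion₂_subset fun k hk => hΩ k (abs_le.2 (Finset.mem_Icc.1 hk))
  refine (closure_minimal (fun x hx => ?_) hKc).trans hKΩ
  have hne : ∫ t, translateSum φ z n β t * translateSum φ z n β (t - x) ≠ 0 := by
    rw [← autocorrelation_apply]
    exact hx
  obtain ⟨t, ht⟩ : ∃ t, translateSum φ z n β t * translateSum φ z n β (t - x) ≠ 0 := by
    by_contra! hzero
    exact hne (by simp [hzero])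
  obtain ⟨i, hi, hi'⟩ := exists_norm_sub_le_of_translateSum_ne_zero hφ (left_ne_zero_of_mul ht)
  obtain ⟨j, hj, hj'⟩ := exists_norm_sub_le_of_translateSum_ne_zero hφ (right_ne_zero_of_mul ht)
  refine Set.mem_biUnion (x := (i : ℤ) - j) (Finset.mem_coe.2 (Finset.mem_Icc.2 (by omega))) ?_
  rw [mem_closedBall_iff_norm]
  have : x - ((i : ℤ) - j) • z = (t - i • z) - (t - x - j • z) := by
    rw [sub_smul, natCast_zsmul, natCast_zsmul]
    abel
  rw [this]
  linarith [norm_sub_le (t - i • z) (t - x - j • z)]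

/-- Distinct multiples of z are at distance at least ‖z‖ ≥ 2δ, so different translates never
overlap. -/
theorem integral_translate_mul_translate (hφ : ∀ x, φ x ≠ 0 → ‖x‖ < δ) (hδ : 2 * δ ≤ ‖z‖)
    (i j : ℕ) : ∫ t, φ (t - i • z) * φ (t - j • z) = if i = j then ∫ t, φ t ^ 2 else 0 := by
  split_ifs with h
  · subst h
    simp only [← pow_two]
    exact integral_sub_right_eq_self (fun t => φ t ^ 2) (i • z)
  · have hzero : ∀ t, φ (t - i • z) * φ (t - j • z) = 0 := by
      intro t
      by_contra hne
      have h1 := hφ _ (left_ne_zero_of_mul hne)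
      have h2 := hφ _ (right_ne_zero_of_mul hne)
      have h3 : ((j : ℤ) - i) • z = (t - i • z) - (t - j • z) := by
        rw [sub_smul, natCast_zsmul, natCast_zsmul]
        abel
      have h4 : ‖((j : ℤ) - i) • z‖ = |((j : ℤ) - i : ℤ)| * ‖z‖ := by
        rw [← Int.cast_smul_eq_zsmul ℝ, norm_smul, Real.norm_eq_abs]
        push_cast
        rfl
      have h5 : (1 : ℝ) ≤ ((|(j : ℤ) - i| : ℤ) : ℝ) := by
        have : (1 : ℤ) ≤ |(j : ℤ) - i| := Int.one_le_abs (by omega)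
        exact_mod_cast this
      rw [h3] at h4
      have h6 := norm_sub_le (t - i • z) (t - j • z)
      nlinarith [norm_nonneg z]
    simp [hzero]

theorem autocorrelation_translateSum_nsmul (hc : Continuous φ) (hφ : ∀ x, φ x ≠ 0 → ‖x‖ < δ)
    (hδ : 2 * δ ≤ ‖z‖) (β : ℕ → ℝ) (m : ℕ) :
    autocorrelation (translateSum φ z n β) (m • z) =
      (∑ i ∈ Finset.range (n + 1), ∑ j ∈ Finset.range (n + 1),
        if i = j + m then β i * β j else 0) * ∫ t, φ t ^ 2 := by
  have hsupp : HasCompactSupport φ := by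
    refine HasCompactSupport.intro (isCompact_closedBall 0 δ) fun x hx => ?_
    by_contra hne
    exact hx (by simpa using (hφ x hne).le)
  have hint : ∀ i j : ℕ, Integrable fun t => φ (t - i • z) * φ (t - (j + m) • z) := by
    intro i j
    refine Continuous.integrable_of_hasCompactSupport (by fun_prop) ?_
    exact (hsupp.comp_homeomorph (Homeomorph.subRight (i • z))).mul_right
  rw [autocorrelation_apply]
  have h1 : ∀ t, translateSum φ z n β t * translateSum φ z n β (t - m • z) =
      ∑ i ∈ Finset.range (n + 1), ∑ j ∈ Finset.range (n + 1),
        β i * β j * (φ (t - i • z) * φ (t - (j + m) • z)) := by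
    intro t
    rw [translateSum, translateSum, Finset.sum_mul_sum]
    refine Finset.sum_congr rfl fun i _ => Finset.sum_congr rfl fun j _ => ?_
    rw [add_smul, sub_sub, add_comm (j • z)]
    ring
  simp only [h1]
  rw [integral_finsetSum _ fun i _ => integrable_finsetSum _ fun j _ => (hint i j).const_mul _,
    Finset.sum_mul]
  refine Finset.sum_congr rfl fun i _ => ?_
  rw [integral_finsetSum _ fun j _ => (hint i j).const_mul _, Finset.sum_mul]
  refine Finset.sum_congr rfl fun j _ => ?_
  rw [integral_const_mul, integral_translate_mul_translate hφ hδ]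
  split_ifs <;> simp

end TranslateSum

/-! ### Fejér's extremal coefficients -/

/-- Multiply the recurrence sin((j+2)α) + sin(jα) = 2 cos α sin((j+1)α) by sin((j+1)α) and sum; only
a boundary term at the upper end survives. -/
theorem cos_mul_sum_sin_sq (α : ℝ) (N : ℕ) :
    2 * Real.cos α * ∑ j ∈ Finset.range N, Real.sin ((j + 1) * α) ^ 2 =
      2 * ∑ j ∈ Finset.range N, Real.sin (j * α) * Real.sin ((j + 1) * α) +
        Real.sin (N * α) * Real.sin ((N + 1) * α) := by
  induction N with
  | zero => simp
  | succ N ih =>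
    rw [Finset.sum_range_succ, Finset.sum_range_succ, mul_add, ih]
    have h : Real.sin ((N + 1 + 1) * α) + Real.sin (N * α) =
        2 * Real.cos α * Real.sin ((N + 1) * α) := by
      rw [show (N + 1 + 1) * α = (N + 1) * α + α by ring,
        show N * α = (N + 1) * α - α by ring, Real.sin_add, Real.sin_sub]
      ring
    push_cast
    linear_combination -Real.sin ((N + 1) * α) * h

/-- The Fejér coefficients, with their first correlation. -/
theorem exists_coeff_correlation (n : ℕ) : ∃ b : ℕ → ℝ,
    0 < ∑ j ∈ Finset.range (n + 1), b j ^ 2 ∧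
    ∑ j ∈ Finset.range n, b (j + 1) * b j =
      Real.cos (Real.pi / (n + 2)) * ∑ j ∈ Finset.range (n + 1), b j ^ 2 := by
  set α : ℝ := Real.pi / (n + 2) with hα
  refine ⟨fun j => Real.sin ((j + 1) * α), ?_, ?_⟩
  · rw [Finset.sum_range_succ']
    have h1 : 0 < Real.sin α := by
      refine Real.sin_pos_of_pos_of_lt_pi (by positivity) ?_
      rw [hα, div_lt_iff₀ (by positivity)]
      nlinarith [Real.pi_pos, Nat.cast_nonneg (α := ℝ) n]
    have h2 : 0 ≤ ∑ j ∈ Finset.range n, Real.sin (((j + 1 : ℕ) + 1) * α) ^ 2 :=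
      Finset.sum_nonneg fun _ _ => sq_nonneg _
    have h3 : 0 < Real.sin (((0 : ℕ) + 1) * α) ^ 2 := by
      simp only [Nat.cast_zero, zero_add, one_mul]
      positivity
    exact add_pos_of_nonneg_of_pos h2 h3
  · have h := cos_mul_sum_sin_sq α (n + 1)
    -- The angle π/(n+2) is chosen to kill the boundary term.
    have h0 : Real.sin (((n + 1 : ℕ) + 1) * α) = 0 := by
      rw [show (((n + 1 : ℕ) : ℝ) + 1) * α = Real.pi by
        rw [hα]; push_cast; field_simp; ring]
      exact Real.sin_pi
    rw [h0, mul_zero, add_zero, Finset.sum_range_succ' (fun j : ℕ =>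
      Real.sin (j * α) * Real.sin ((j + 1) * α))] at h
    simp only [Nat.cast_zero, zero_mul, Real.sin_zero, add_zero] at h
    have h4 : ∑ j ∈ Finset.range n, Real.sin (((j + 1 : ℕ) + 1) * α) * Real.sin ((j + 1) * α) =
        ∑ j ∈ Finset.range n, Real.sin ((j + 1 : ℕ) * α) * Real.sin (((j + 1 : ℕ) + 1) * α) := by
      refine Finset.sum_congr rfl fun j _ => ?_
      push_cast
      ring
    linarith

theorem sum_sum_eq_add_one (b : ℕ → ℝ) (n : ℕ) :
    (∑ i ∈ Finset.range (n + 1), ∑ j ∈ Finset.range (n + 1),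
      if i = j + 1 then b i * b j else 0) = ∑ j ∈ Finset.range n, b (j + 1) * b j := by
  rw [Finset.sum_comm, Finset.sum_range_succ]
  simp only [Finset.sum_ite_eq', Finset.mem_range]
  rw [if_neg (by omega), add_zero]
  exact Finset.sum_congr rfl fun j hj => if_pos (by simpa using hj)

/-! ### The extremal function and the conclusion -/

theorem exists_radius_closedBall_zsmul_subset {d : ℕ} {Ω : Set (RSpace d)} {z : RSpace d} {n : ℕ}
    (hopen : IsOpen Ω) (hz : z ≠ 0) (hΩ : ∀ k : ℤ, |k| ≤ n → k • z ∈ Ω) :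
    ∃ δ : ℝ, 0 < δ ∧ 2 * δ ≤ ‖z‖ ∧
      ∀ k : ℤ, |k| ≤ n → Metric.closedBall (k • z) (2 * δ) ⊆ Ω := by
  set K : Set (RSpace d) := (fun k : ℤ => k • z) '' Set.Icc (-(n : ℤ)) n with hKdef
  have hmem : ∀ k : ℤ, |k| ≤ n → k • z ∈ K := fun k hk => Set.mem_image_of_mem _ (abs_le.1 hk)
  have hK : IsCompact K := ((Set.finite_Icc _ _).image _).isCompact
  have hKΩ : K ⊆ Ω := Set.image_subset_iff.2 fun k hk => hΩ k (abs_le.2 hk)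
  obtain ⟨ε, hε, hεΩ⟩ := hK.exists_cthickening_subset_open hopen hKΩ
  have hz' : 0 < ‖z‖ := norm_pos_iff.2 hz
  refine ⟨min ε ‖z‖ / 2, half_pos (lt_min hε hz'), by linarith [min_le_right ε ‖z‖],
    fun k hk => ?_⟩
  exact (Metric.closedBall_subset_closedBall (by linarith [min_le_left ε ‖z‖])).trans
    ((Metric.closedBall_subset_cthickening (hmem k hk) ε).trans hεΩ)

theorem exists_contDiff_support_ball_integral_sq_pos (d : ℕ) {δ : ℝ} (hδ0 : 0 < δ) :
    ∃ φ : RSpace d → ℝ, ContDiff ℝ ∞ φ ∧ (∀ x, φ x ≠ 0 → ‖x‖ < δ) ∧ 0 < ∫ t, φ t ^ 2 := by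
  let φ : ContDiffBump (0 : RSpace d) := ⟨δ / 2, δ, by positivity, by linarith⟩
  refine ⟨φ, φ.contDiff, fun x hx => ?_, ?_⟩
  · have : x ∈ Function.support φ := hx
    rw [φ.support_eq] at this
    simpa [φ] using this
  · refine Continuous.integral_pos_of_hasCompactSupport_nonneg_nonzero (x := 0)
      (φ.continuous.pow 2) ?_ (fun x => sq_nonneg _) ?_
    · simp only [pow_two]
      exact φ.hasCompactSupport.mul_right
    · have : φ 0 = 1 := φ.one_of_mem_closedBall (Metric.mem_closedBall_self φ.rIn_pos.le)
      rw [this]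
      norm_num

/-- A compactly supported smooth function that attains the extremal value in every class. -/
theorem exists_extremal_function {d : ℕ} {Ω : Set (RSpace d)} {z : RSpace d} {n : ℕ}
    (hopen : IsOpen Ω) (hz : z ≠ 0) (hΩ : ∀ k : ℤ, |k| ≤ n → k • z ∈ Ω) :
    ∃ f : RSpace d → ℝ, tsupport f ⊆ Ω ∧ f 0 = 1 ∧ IsPosDefFourier f ∧ IsPosDefPointwise f ∧
      ContDiff ℝ ∞ f ∧ HasCompactSupport f ∧ f z = Real.cos (Real.pi / (n + 2)) := by
  obtain ⟨δ, hδ0, hδz, hδΩ⟩ := exists_radius_closedBall_zsmul_subset hopen hz hΩ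
  obtain ⟨φ, hφc, hφ, hA⟩ := exists_contDiff_support_ball_integral_sq_pos d hδ0
  obtain ⟨b, hb, hbc⟩ := exists_coeff_correlation n
  set A := ∫ t, φ t ^ 2 with hAdef
  set B := ∑ j ∈ Finset.range (n + 1), b j ^ 2 with hBdef
  -- Before scaling, the autocorrelation at 0 is A B; scaling the coefficients by r multiplies it by
  -- r², giving 1.
  set r := (Real.sqrt (A * B))⁻¹ with hr
  have hr2 : r ^ 2 * (A * B) = 1 := by
    rw [hr, inv_pow, Real.sq_sqrt (by positivity), inv_mul_cancel₀ (by positivity)]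
  set F := translateSum φ z n fun j => r * b j with hF
  have hFs : ContDiff ℝ ∞ F := contDiff_translateSum hφc _
  have hFc : HasCompactSupport F := hasCompactSupport_translateSum hφ _
  refine ⟨autocorrelation F, tsupport_autocorrelation_translateSum_subset hφ _ hδΩ, ?_,
    isPosDefFourier_autocorrelation hFs.continuous hFc,
    isPosDefPointwise_autocorrelation hFs.continuous hFc, contDiff_autocorrelation hFs hFc,
    hasCompactSupport_autocorrelation hFc, ?_⟩
  · have h := autocorrelation_translateSum_nsmul (n := n) hφc.continuous hφ hδz
      (fun j => r * b j) 0
    simp only [zero_smul, add_zero, Finset.sum_ite_eq, Finset.mem_range] at h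
    rw [h, Finset.sum_congr rfl fun i hi => if_pos (Finset.mem_range.1 hi), ← hr2, hBdef,
      mul_comm A, ← mul_assoc, Finset.mul_sum]
    congr 1
    exact Finset.sum_congr rfl fun i _ => by ring
  · have h := autocorrelation_translateSum_nsmul (n := n) hφc.continuous hφ hδz
      (fun j => r * b j) 1
    rw [one_smul, sum_sum_eq_add_one (fun j => r * b j)] at h
    have h2 : ∑ j ∈ Finset.range n, r * b (j + 1) * (r * b j) =
        r ^ 2 * ∑ j ∈ Finset.range n, b (j + 1) * b j := by
      rw [Finset.mul_sum]
      exact Finset.sum_congr rfl fun i _ => by ring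
    rw [h, h2, hbc]
    linear_combination Real.cos (Real.pi / (n + 2)) * hr2

theorem extremalValue_eq {d : ℕ} {F : Set (RSpace d → ℝ)} {z : RSpace d} {M : ℝ}
    (hle : ∀ f ∈ F, f z ≤ M) {g : RSpace d → ℝ} (hg : g ∈ F) (hgz : g z = M) :
    extremalValue F z = (M : EReal) := by
  refine le_antisymm (iSup₂_le fun f hf => EReal.coe_le_coe_iff.2 (hle f hf)) ?_
  rw [← hgz]
  exact le_iSup₂ (f := fun (f : RSpace d → ℝ) (_ : f ∈ F) => ((f z : ℝ) : EReal)) g hg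

theorem mainTheorem4 (d : ℕ) (Ω : Set (RSpace d)) (hopen : IsOpen Ω) (hconv : Convex ℝ Ω)
    (hsymm : ∀ x ∈ Ω, -x ∈ Ω) (z : RSpace d) (n : ℕ) (hn : 1 ≤ n)
    (hz₁ : 1 / ((n : ℝ) + 1) ≤ gauge Ω z) (hz₂ : gauge Ω z < 1 / (n : ℝ)) :
    extremalC Ω z = ((Real.cos (Real.pi / ((n : ℝ) + 2)) : ℝ) : EReal) ∧
    extremalL1 Ω z = ((Real.cos (Real.pi / ((n : ℝ) + 2)) : ℝ) : EReal) ∧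
    extremalSmooth Ω z = ((Real.cos (Real.pi / ((n : ℝ) + 2)) : ℝ) : EReal) ∧
    extremalPointwise Ω z = ((Real.cos (Real.pi / ((n : ℝ) + 2)) : ℝ) : EReal) := by
  have hgauge : 0 < gauge Ω z := lt_of_lt_of_le (by positivity) hz₁
  have h0 := zero_mem_of_gauge_pos hconv hsymm hgauge
  have hz : z ≠ 0 := by
    rintro rfl
    simp at hgauge
  obtain ⟨g, hgs, hg0, hgF, hgP, hgd, hgc, hgz⟩ := exists_extremal_function (n := n) hopen hz
    fun k hk => zsmul_mem_of_gauge_lt hopen hconv hsymm h0 hn hz₂ hk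
  have hout : ∀ f : RSpace d → ℝ, tsupport f ⊆ Ω →
      ∀ k : ℤ, (n : ℤ) < |k| → k • z ∉ tsupport f := fun f hf k hk hmem =>
    zsmul_notMem_of_le_gauge hopen hsymm hz₁ hk (hf hmem)
  refine ⟨?_, ?_, ?_, ?_⟩
  · refine extremalValue_eq ?_ ⟨hgs, hg0, hgF, hgd.continuous⟩ hgz
    rintro f ⟨hs, h1, hF, hc⟩
    exact hF.le_cos hn (hout f hs) h1 hc.continuousAt hc.continuousAt
  · refine extremalValue_eq ?_
      ⟨hgs, hg0, hgF, hgd.continuous.continuousAt, hgd.continuous.continuousAt⟩ hgz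
    rintro f ⟨hs, h1, hF, hc0, hcz⟩
    exact hF.le_cos hn (hout f hs) h1 hc0 hcz
  · refine extremalValue_eq ?_ ⟨hgs, hg0, hgF, hgd, hgc⟩ hgz
    rintro f ⟨hs, h1, hF, hd, _⟩
    exact hF.le_cos hn (hout f hs) h1 hd.continuous.continuousAt hd.continuous.continuousAt
  · refine extremalValue_eq ?_ ⟨hgs, hg0, hgP, hgd.continuous⟩ hgz
    rintro f ⟨hs, h1, hP, _⟩
    exact hP.le_cos hn (hout f hs) h1
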